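/- Fix finite sets $I$ of input signals and $O$ of output signals. LTL formulas over $I\cup O$ are built from $\mathit{true}$, signals, $\neg$, $\vee$, $\mathsf X$ and $\mathsf U$, with $\mathsf F\psi=\mathit{true}\,\mathsf U\,\psi$ and $\mathsf G\psi=\neg\mathsf F\neg\psi$; the size $|\varphi|$ is the number of (distinct) subformulas of $\varphi$. A Mealy machine $\mathcal M$ has a finite set $T$ of states, an initial state $t_I$, a transition function $\delta:T\times 2^I\to T$ and an output function $\lambda:T\times 2^I\to 2^O$. It is an implementation of $\varphi$ if, for every input word $\nu_0\nu_1\ldots\in(2^I)^\omega$ and the induced run $t_0=t_I$, $t_{k+1}=\delta(t_k,\nu_k)$, the word $\sigma_k=\nu_k\cup\lambda(t_k,\nu_k)$ $(k\ge 0)$ satisfies $\varphi$; and $\varphi$ is realizable if it has an implementation. A cycle of $\mathcal M$ is a simple cycle of the directed graph on $T$ with edges $\{(t,t')\mid \exists\nu\subseteq I.\ \delta(t,\nu)=t'\}$, that is, a pair $(C,\eta)$ of a non-empty set $C\subseteq T$ and a bijection $\eta:C\to C$ such that $(v,\eta(v))$ is an edge for all $v\in C$, and $\eta^k(v)=v\Leftrightarrow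 |C|$ divides $k$, for all $v\in C$ and $k\in\mathbb N$. **Theorem.** There are LTL specifications $\varphi_n$, $n>1$, each over its own finite sets of input and output signals, with $|\varphi_n|\in\Theta(n)$, such that for every $n>1$: the only temporal operators in $\varphi_n$ are $\mathsf X$, $\mathsf G$ and $\mathsf F$; $\varphi_n$ is realizable; and every implementation of $\varphi_n$ has at least triply exponentially many cycles in $n$, namely at least $2^{2^{2^n}}$. -/

import Mathlib

/-- Formulas of linear-time temporal logic over the atomic propositions `AP`. -/
inductive LTL (AP : Type) : Type where
  | tru : LTL AP
  | atom : AP → LTL AP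
  | not : LTL AP → LTL AP
  | or : LTL AP → LTL AP → LTL AP
  | next : LTL AP → LTL AP
  | untl : LTL AP → LTL AP → LTL AP

namespace LTL

variable {AP : Type}

/-- `F φ`, that is, `true U φ`. -/
def eventually (φ : LTL AP) : LTL AP := untl tru φ

/-- `G φ`, that is, `¬ F ¬ φ`. -/
def globally (φ : LTL AP) : LTL AP := not (eventually (not φ))

/-- `φ.Sat α n` is the satisfaction `α, n ⊨ φ` at position `n` of the infinite word `α`. -/
def Sat (α : ℕ → Set AP) : ℕ → LTL AP → Prop
  | _, tru => True
  | n, atom a => a ∈ α n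
  | n, not φ => ¬ Sat α n φ
  | n, or φ ψ => Sat α n φ ∨ Sat α n ψ
  | n, next φ => Sat α (n + 1) φ
  | n, untl φ ψ => ∃ m, n ≤ m ∧ Sat α m ψ ∧ ∀ i, n ≤ i → i < m → Sat α i φ

/-- The language of a formula: all infinite words over `2^AP` that satisfy it at position `0`. -/
def language (φ : LTL AP) : Set (ℕ → Set AP) := {α | Sat α 0 φ}

/-- The set of subformulas, including the formula itself. -/
def subformulas : LTL AP → Set (LTL AP)
  | tru => {tru}
  | atom a => {atom a}
  | not φ => insert (not φ) (subformulas φ)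
  | or φ ψ => insert (or φ ψ) (subformulas φ ∪ subformulas ψ)
  | next φ => insert (next φ) (subformulas φ)
  | untl φ ψ => insert (untl φ ψ) (subformulas φ ∪ subformulas ψ)

theorem subformulas_finite (φ : LTL AP) : φ.subformulas.Finite := by
  induction φ with
  | tru => exact Set.finite_singleton _
  | atom a => exact Set.finite_singleton _
  | not φ h => exact h.insert _
  | or φ ψ h₁ h₂ => exact (h₁.union h₂).insert _
  | next φ h => exact h.insert _
  | untl φ ψ h₁ h₂ => exact (h₁.union h₂).insert _

/-- The size of a formula: its number of subformulas. -/
noncomputable def size (φ : LTL AP) : ℕ := φ.subformulas.ncard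

/-- The fragment in which the only temporal operators are `X`, `G` and `F`. -/
inductive OnlyXGF : LTL AP → Prop where
  | tru : OnlyXGF tru
  | atom (a : AP) : OnlyXGF (atom a)
  | not {φ : LTL AP} : OnlyXGF φ → OnlyXGF (not φ)
  | or {φ ψ : LTL AP} : OnlyXGF φ → OnlyXGF ψ → OnlyXGF (or φ ψ)
  | next {φ : LTL AP} : OnlyXGF φ → OnlyXGF (next φ)
  | globally {φ : LTL AP} : OnlyXGF φ → OnlyXGF (globally φ)
  | eventually {φ : LTL AP} : OnlyXGF φ → OnlyXGF (eventually φ)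

end LTL

/-- The simple cycles `(C, η)` of the directed graph on `V` with edge relation `E`: `C` is a
non-empty set of vertices and `η` a bijection of `C` that moves along edges and has a single orbit. -/
def simpleCycles {V : Type} (E : V → V → Prop) : Set (Σ C : Set V, Equiv.Perm C) :=
  {c | c.1.Nonempty ∧ (∀ v : c.1, E v (c.2 v)) ∧
    ∀ (v : c.1) (k : ℕ), c.2^[k] v = v ↔ k % c.1.ncard = 0}

/-- Mealy machines over input signals `I` and output signals `O`. -/
structure MealyMachine (I O : Type) where
  State : Type
  finite_state : Finite State
  init : State
  /-- transition function -/
  step : State → Set I → State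
  /-- output function -/
  out : State → Set I → Set O

namespace MealyMachine

variable {I O : Type}

/-- The paths of a Mealy machine. The signals are `I ⊕ O`, so that `Sum.inl ⁻¹' σ` is the input part
and `Sum.inr ⁻¹' σ` the output part of a letter `σ`. -/
def paths (M : MealyMachine I O) : Set (ℕ → M.State × Set (I ⊕ O)) :=
  {p | (p 0).1 = M.init ∧ ∀ n,
    M.step (p n).1 (Sum.inl ⁻¹' (p n).2) = (p (n + 1)).1 ∧
    M.out (p n).1 (Sum.inl ⁻¹' (p n).2) = Sum.inr ⁻¹' (p n).2}

/-- `M` is an implementation of `φ`: the words along all paths of `M` satisfy `φ`. -/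
def Implements (M : MealyMachine I O) (φ : LTL (I ⊕ O)) : Prop :=
  (fun p n => (p n).2) '' M.paths ⊆ φ.language

/-- The state graph, which ignores the input labels. -/
def Edge (M : MealyMachine I O) (t t' : M.State) : Prop := ∃ ν : Set I, M.step t ν = t'

/-- The set of cycles of a Mealy machine. -/
def cycles (M : MealyMachine I O) : Set (Σ C : Set M.State, Equiv.Perm C) := simpleCycles M.Edge

theorem cycles_finite (M : MealyMachine I O) : M.cycles.Finite := by
  classical
  have := M.finite_state
  exact Set.toFinite _

end MealyMachine

/-- A specification is realizable if it has an implementation. -/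
def LTL.Realizable {I O : Type} (φ : LTL (I ⊕ O)) : Prop :=
  ∃ M : MealyMachine I O, M.Implements φ

/-!
The specification makes the system a memory with one bit for each set of `n` address signals, that
is, for each of `2 ^ n` addresses. Every input letter writes one bit; a letter marked as the query
asks for the bit stored at its address. Since a query may come at any time with any address, a state
reached without a query determines all stored bits, so a Gray code drives every implementation
through all `N = 2 ^ 2 ^ n` memory contents periodically, and the states reached know the time
modulo `N`. Each letter also carries a side bit that the system has to repeat one step later, so
that the state after the letter determines this bit.

Fix one side bit for each residue modulo `N` and feed the Gray code forever. The walk traverses a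
simple cycle, and as the time modulo `N` agrees at its ends, the cycle passes every residue. Its
vertices therefore reveal all `N` side bits, and the `2 ^ N` choices of side bits give as many
cycles.
-/

namespace LTL

variable {AP : Type}

/-- Conjunction, as a derived connective. -/
def and (φ ψ : LTL AP) : LTL AP := not (or (not φ) (not ψ))

/-- Implication, as a derived connective. -/
def imp (φ ψ : LTL AP) : LTL AP := or (not φ) ψ

/-- Equivalence, as a derived connective. -/
def iff (φ ψ : LTL AP) : LTL AP := and (imp φ ψ) (imp ψ φ)

/-- The conjunction of a list of formulas. -/
def conj : List (LTL AP) → LTL AP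
  | [] => tru
  | φ :: l => and φ (conj l)

section Sat

variable {α : ℕ → Set AP} {k : ℕ} {φ ψ : LTL AP}

theorem sat_not : Sat α k (not φ) ↔ ¬ Sat α k φ := Iff.rfl

theorem sat_or : Sat α k (or φ ψ) ↔ Sat α k φ ∨ Sat α k ψ := Iff.rfl

theorem sat_next : Sat α k (next φ) ↔ Sat α (k + 1) φ := Iff.rfl

theorem sat_and : Sat α k (and φ ψ) ↔ Sat α k φ ∧ Sat α k ψ := by
  simp only [and, sat_not, sat_or, not_or, not_not]

theorem sat_imp : Sat α k (imp φ ψ) ↔ (Sat α k φ → Sat α k ψ) := by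
  simp only [imp, sat_not, sat_or, imp_iff_not_or]

theorem sat_iff : Sat α k (iff φ ψ) ↔ (Sat α k φ ↔ Sat α k ψ) := by
  simp only [iff, sat_and, sat_imp, iff_def]

theorem sat_eventually : Sat α k (eventually φ) ↔ ∃ m, k ≤ m ∧ Sat α m φ := by
  simp [eventually, Sat]

theorem sat_globally : Sat α k (globally φ) ↔ ∀ m, k ≤ m → Sat α m φ := by
  simp only [globally, sat_not, sat_eventually, not_exists, not_and, not_not]

theorem sat_conj {l : List (LTL AP)} : Sat α k (conj l) ↔ ∀ χ ∈ l, Sat α k χ := by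
  induction l with
  | nil => simp [conj, Sat]
  | cons χ l ih => simp [conj, sat_and, ih]

end Sat

namespace OnlyXGF

variable {φ ψ : LTL AP}

theorem and (hφ : OnlyXGF φ) (hψ : OnlyXGF ψ) : OnlyXGF (φ.and ψ) := (hφ.not.or hψ.not).not

theorem imp (hφ : OnlyXGF φ) (hψ : OnlyXGF ψ) : OnlyXGF (φ.imp ψ) := hφ.not.or hψ

theorem iff (hφ : OnlyXGF φ) (hψ : OnlyXGF ψ) : OnlyXGF (φ.iff ψ) := (hφ.imp hψ).and (hψ.imp hφ)

theorem conj {l : List (LTL AP)} (h : ∀ χ ∈ l, OnlyXGF χ) : OnlyXGF (LTL.conj l) := by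
  induction l with
  | nil => exact .tru
  | cons χ l ih =>
    rw [List.forall_mem_cons] at h
    exact h.1.and (ih h.2)

end OnlyXGF

/-- The number of nodes of the syntax tree, which bounds the size: the latter counts a repeated
subformula once. -/
def length : LTL AP → ℕ
  | tru => 1
  | atom _ => 1
  | not φ => φ.length + 1
  | or φ ψ => φ.length + ψ.length + 1
  | next φ => φ.length + 1
  | untl φ ψ => φ.length + ψ.length + 1

theorem size_le_length (φ : LTL AP) : φ.size ≤ φ.length := by
  have unary {χ φ : LTL AP} (h : φ.size ≤ φ.length) :
      (insert χ φ.subformulas).ncard ≤ φ.length + 1 :=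
    (Set.ncard_insert_le _ _).trans (Nat.succ_le_succ h)
  have binary {χ φ ψ : LTL AP} (hφ : φ.size ≤ φ.length) (hψ : ψ.size ≤ ψ.length) :
      (insert χ (φ.subformulas ∪ ψ.subformulas)).ncard ≤ φ.length + ψ.length + 1 :=
    (Set.ncard_insert_le _ _).trans
      (Nat.succ_le_succ ((Set.ncard_union_le _ _).trans (Nat.add_le_add hφ hψ)))
  induction φ with
  | tru => exact (Set.ncard_singleton _).le
  | atom a => exact (Set.ncard_singleton _).le
  | not φ h => exact unary h
  | or φ ψ hφ hψ => exact binary hφ hψ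
  | next φ h => exact unary h
  | untl φ ψ hφ hψ => exact binary hφ hψ

theorem length_conj_le {l : List (LTL AP)} {c : ℕ} (h : ∀ χ ∈ l, χ.length ≤ c) :
    (conj l).length ≤ (c + 4) * l.length + 1 := by
  induction l with
  | nil => simp [conj, length]
  | cons χ l ih =>
    rw [List.forall_mem_cons] at h
    simp only [conj, and, length, List.length_cons]
    linarith [h.1, ih h.2]

theorem self_mem_subformulas (φ : LTL AP) : φ ∈ φ.subformulas := by
  cases φ <;> simp [subformulas]

theorem mem_subformulas_and {θ φ ψ : LTL AP} (h : θ ∈ φ.subformulas ∪ ψ.subformulas) :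
    θ ∈ (φ.and ψ).subformulas := by
  rcases h with h | h <;> simp [and, subformulas, h]

theorem mem_subformulas_iff {θ φ ψ : LTL AP} (h : θ ∈ φ.subformulas ∪ ψ.subformulas) :
    θ ∈ (φ.iff ψ).subformulas := by
  refine mem_subformulas_and (Or.inl ?_)
  rcases h with h | h <;> simp [imp, subformulas, h]

theorem mem_subformulas_conj {l : List (LTL AP)} {χ θ : LTL AP} (hχ : χ ∈ l)
    (hθ : θ ∈ χ.subformulas) : θ ∈ (conj l).subformulas := by
  induction l with
  | nil => simp at hχ
  | cons χ' l ih =>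
    rcases List.mem_cons.1 hχ with rfl | hχ
    · exact mem_subformulas_and (Or.inl hθ)
    · exact mem_subformulas_and (Or.inr (ih hχ))

theorem card_le_size_of_injective {κ : Type*} {φ : LTL AP} {a : κ → AP}
    (ha : Function.Injective a) (h : ∀ i, atom (a i) ∈ φ.subformulas) : Nat.card κ ≤ φ.size := by
  have hinj : Function.Injective fun i => atom (a i) := fun i j hij => ha (atom.inj hij)
  rw [← Set.ncard_range_of_injective hinj]
  exact Set.ncard_le_ncard (Set.range_subset_iff.2 h) φ.subformulas_finite

end LTL

namespace MealyMachine

variable {I O : Type} (M : MealyMachine I O)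

/-- The state sequence induced by an input word. -/
def run (w : ℕ → Set I) : ℕ → M.State
  | 0 => M.init
  | k + 1 => M.step (run w k) (w k)

/-- The word of input and output signals induced by an input word. -/
def trace (w : ℕ → Set I) (k : ℕ) : Set (I ⊕ O) :=
  Sum.inl '' w k ∪ Sum.inr '' M.out (M.run w k) (w k)

variable {w : ℕ → Set I} {k : ℕ}

theorem inl_preimage_trace : Sum.inl ⁻¹' M.trace w k = w k := by
  ext
  simp [trace]

theorem inr_preimage_trace : Sum.inr ⁻¹' M.trace w k = M.out (M.run w k) (w k) := by
  ext
  simp [trace]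

theorem sat_input {x : I} : LTL.Sat (M.trace w) k (.atom (.inl x)) ↔ x ∈ w k := by
  simp [LTL.Sat, trace]

theorem sat_output {x : O} :
    LTL.Sat (M.trace w) k (.atom (.inr x)) ↔ x ∈ M.out (M.run w k) (w k) := by
  simp [LTL.Sat, trace]

open Function (update) in
theorem run_update {j : ℕ} (hj : j ≤ k) (ν : Set I) : M.run (update w k ν) j = M.run w j := by
  induction j with
  | zero => rfl
  | succ j ih => rw [run, run, ih (by omega), Function.update_of_ne (by omega)]

theorem paths_eq_range : M.paths = Set.range fun w k => (M.run w k, M.trace w k) := by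
  apply Set.Subset.antisymm
  · rintro p ⟨hinit, hp⟩
    let w : ℕ → Set I := fun k => Sum.inl ⁻¹' (p k).2
    have hrun (k : ℕ) : M.run w k = (p k).1 := by
      induction k with
      | zero => exact hinit.symm
      | succ k ih => rw [run, ih, (hp k).1]
    have htrace (k : ℕ) : M.trace w k = (p k).2 := by
      rw [trace, hrun, (hp k).2, Set.image_preimage_inl_union_image_preimage_inr]
    exact ⟨w, funext fun k => Prod.ext (hrun k) (htrace k)⟩
  · rintro _ ⟨w, rfl⟩
    refine ⟨rfl, fun k => ?_⟩
    simp only [inl_preimage_trace, inr_preimage_trace, run, and_self]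

theorem implements_iff {φ : LTL (I ⊕ O)} : M.Implements φ ↔ ∀ w, LTL.Sat (M.trace w) 0 φ := by
  rw [Implements, paths_eq_range, ← Set.range_comp, Set.range_subset_iff]
  rfl

end MealyMachine

theorem rel_zmod_val_add_one {V : Type*} {R : V → V → Prop} {d : ℕ} [NeZero d] {f : ℕ → V}
    (hstep : ∀ k, k + 1 < d → R (f k) (f (k + 1))) (hlast : R (f (d - 1)) (f 0)) (t : ZMod d) :
    R (f t.val) (f (t + 1).val) := by
  have hval : (t + 1).val = (t.val + 1) % d := by
    rw [← ZMod.val_natCast, Nat.cast_add, ZMod.natCast_zmod_val, Nat.cast_one]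
  rcases (Nat.succ_le_of_lt t.val_lt).lt_or_eq with hlt | heq
  · rw [hval, Nat.mod_eq_of_lt hlt]
    exact hstep _ hlt
  · rw [hval, ← Nat.succ_eq_add_one, heq, Nat.mod_self, show t.val = d - 1 by omega]
    exact hlast

theorem exists_injective_cycle_of_isChain {V : Type*} {R : V → V → Prop} {l : List V} {d : ℕ}
    [NeZero d] (hlength : l.length = d) (hnodup : l.Nodup) (hchain : l.IsChain R) {x y : V}
    (hx : l.head? = some x) (hy : l.getLast? = some y) (hyx : R y x) :
    ∃ g : ZMod d → V, Function.Injective g ∧ g 0 = x ∧ ∀ t, R (g t) (g (t + 1)) := by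
  have hget {k : ℕ} (hk : k < d) : l.getD k x = l[k] := List.getD_eq_getElem _ _ (by omega)
  have hfirst : l.getD 0 x = x := by
    rw [List.getD_eq_getElem?_getD, ← List.head?_eq_getElem?, hx, Option.getD_some]
  have hlast : l.getD (d - 1) x = y := by
    rw [List.getD_eq_getElem?_getD, ← hlength, ← List.getLast?_eq_getElem?, hy, Option.getD_some]
  refine ⟨fun t => l.getD t.val x, fun s t hst => ?_, ?_,
    rel_zmod_val_add_one (f := fun k => l.getD k x) (fun k hk => ?_) ?_⟩
  · simp only [hget s.val_lt, hget t.val_lt] at hst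
    exact ZMod.val_injective d (hnodup.getElem_inj_iff.1 hst)
  · simpa only [ZMod.val_zero] using hfirst
  · simp only [hget hk, hget (Nat.lt_of_succ_lt hk)]
    exact List.isChain_iff_getElem.1 hchain k (by omega)
  · simpa only [hfirst, hlast] using hyx

section SimpleCycles

variable {V : Type} {E : V → V → Prop}

theorem exists_simpleCycle_of_injective {d : ℕ} [NeZero d] {v : ZMod d → V}
    (hv : Function.Injective v) (hE : ∀ t, E (v t) (v (t + 1))) :
    ∃ c ∈ simpleCycles E, c.1 = Set.range v := by
  let e : ZMod d ≃ Set.range v := Equiv.ofInjective v hv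
  let η : Equiv.Perm (Set.range v) := e.permCongr (Equiv.addRight 1)
  have hη (t : ZMod d) : η (e t) = e (t + 1) := by simp [η, Equiv.permCongr_apply]
  have hiter (k : ℕ) (t : ZMod d) : η^[k] (e t) = e (t + k) := by
    induction k with
    | zero => simp
    | succ k ih => rw [Function.iterate_succ_apply', ih, hη, Nat.cast_succ, add_assoc]
  refine ⟨⟨Set.range v, η⟩, ⟨Set.range_nonempty v, e.surjective.forall.2 fun t => ?_,
    e.surjective.forall.2 fun t k => ?_⟩, rfl⟩
  · rw [hη]
    exact hE t
  · rw [hiter, e.injective.eq_iff, add_eq_left, ZMod.natCast_eq_zero_iff,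
      Set.ncard_range_of_injective hv, Nat.card_zmod, Nat.dvd_iff_mod_eq_zero]

theorem exists_simpleCycle_of_injOn_Ico {f : ℕ → V} {i d : ℕ} (hd : 0 < d)
    (hE : ∀ k, E (f k) (f (k + 1))) (hf : f (i + d) = f i)
    (hinj : Set.InjOn f (Set.Ico i (i + d))) :
    ∃ c ∈ simpleCycles E, c.1 = f '' Set.Ico i (i + d) := by
  have : NeZero d := ⟨hd.ne'⟩
  have hmem (t : ZMod d) : i + t.val ∈ Set.Ico i (i + d) := by
    simpa using t.val_lt
  obtain ⟨c, hc, hc_range⟩ := exists_simpleCycle_of_injective (v := fun t : ZMod d => f (i + t.val))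
    (fun s t hst => ZMod.val_injective d (Nat.add_left_cancel (hinj (hmem s) (hmem t) hst)))
    (rel_zmod_val_add_one (f := fun k => f (i + k)) (fun k _ => hE (i + k)) (by
      have := hE (i + (d - 1))
      rwa [add_assoc, Nat.sub_add_cancel hd, hf] at this))
  refine ⟨c, hc, hc_range.trans (Set.Subset.antisymm ?_ ?_)⟩
  · rintro _ ⟨t, rfl⟩
    exact ⟨_, hmem t, rfl⟩
  · rintro _ ⟨k, ⟨hik, hkd⟩, rfl⟩
    refine ⟨((k - i : ℕ) : ZMod d), ?_⟩
    dsimp only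
    rw [ZMod.val_natCast_of_lt (by omega), Nat.add_sub_cancel' hik]

theorem exists_return_injOn_Ico {α : Type*} [Finite α] (f : ℕ → α) :
    ∃ i d, 0 < d ∧ f (i + d) = f i ∧ Set.InjOn f (Set.Ico i (i + d)) := by
  classical
  have hreturn : ∃ d, 0 < d ∧ ∃ i, f (i + d) = f i := by
    obtain ⟨j, k, hjk, h⟩ := Finite.exists_ne_map_eq_of_infinite f
    wlog hlt : j < k generalizing j k
    · exact this k j hjk.symm h.symm (by omega)
    exact ⟨k - j, by omega, j, by rw [Nat.add_sub_cancel' hlt.le, h]⟩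
  obtain ⟨hd, i, hi⟩ := Nat.find_spec hreturn
  refine ⟨i, Nat.find hreturn, hd, hi, fun j hj k hk h => ?_⟩
  by_contra hjk
  wlog hlt : j < k generalizing j k
  · exact this k hk j hj h.symm (Ne.symm hjk) (by omega)
  exact Nat.find_min hreturn (m := k - j) (by have := hj.1; have := hk.2; omega)
    ⟨by omega, j, by rw [Nat.add_sub_cancel' hlt.le, h]⟩

theorem two_pow_le_ncard_simpleCycles [Finite V] {N : ℕ} [NeZero N] {f : Set (ZMod N) → ℕ → V}
    (hE : ∀ β k, E (f β k) (f β (k + 1)))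
    (hf : ∀ β γ k l, f β k = f γ l → (k : ZMod N) = l ∧ ((k : ZMod N) ∈ β ↔ (l : ZMod N) ∈ γ)) :
    2 ^ N ≤ (simpleCycles E).ncard := by
  choose i d hd hreturn hinj using fun β => exists_return_injOn_Ico (f β)
  choose c hc hc_image using fun β =>
    exists_simpleCycle_of_injOn_Ico (hd β) (hE β) (hreturn β) (hinj β)
  have hlength (β) : N ≤ d β := by
    have := (hf β β _ _ (hreturn β)).1
    rw [Nat.cast_add, add_eq_left, ZMod.natCast_eq_zero_iff] at this
    exact Nat.le_of_dvd (hd β) this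
  have hsubset (β γ) (h : c β = c γ) : β ⊆ γ := by
    intro t ht
    let k := i β + (t - i β).val
    have hkt : (k : ZMod N) = t := by simp [k]
    have hk : f β k ∈ f γ '' Set.Ico (i γ) (i γ + d γ) := by
      rw [← hc_image, ← h, hc_image]
      exact ⟨k, ⟨by omega, by have := (t - i β).val_lt; have := hlength β; omega⟩, rfl⟩
    obtain ⟨l, -, hl⟩ := hk
    obtain ⟨hlk, hmem⟩ := hf γ β l k hl
    rw [hlk, hkt] at hmem
    exact hmem.2 ht
  have hc_injective : Function.Injective c := fun β γ h =>
    (hsubset β γ h).antisymm (hsubset γ β h.symm)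
  calc 2 ^ N = (Set.range c).ncard := by
        rw [Set.ncard_range_of_injective hc_injective, Nat.card_eq_fintype_card, Fintype.card_set,
          ZMod.card]
    _ ≤ (simpleCycles E).ncard := Set.ncard_le_ncard (Set.range_subset_iff.2 hc)

end SimpleCycles

section GrayCode

variable {α : Type*}

/-- `X` and `Y` differ in at most one element. Here `a` is an element that the step from `X` to `Y`
may add or remove; it has to exist even if `X = Y`. -/
def DifferAtMostOnce (X Y : Set α) : Prop := ∃ a, ∀ b ≠ a, b ∈ X ↔ b ∈ Y

theorem DifferAtMostOnce.symm {X Y : Set α} (h : DifferAtMostOnce X Y) : DifferAtMostOnce Y X :=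
  h.imp fun _ h b hb => (h b hb).symm

theorem differAtMostOnce_insert (a : α) (X : Set α) : DifferAtMostOnce X (insert a X) :=
  ⟨a, fun b hb => by simp [hb]⟩

theorem DifferAtMostOnce.insert {X Y : Set α} (h : DifferAtMostOnce X Y) (a : α) :
    DifferAtMostOnce (insert a X) (insert a Y) :=
  h.imp fun _ h b hb => by simp [h b hb]

/-- The reflected Gray code, which lists the sets of elements of a list. -/
def grayCode : List α → List (Set α)
  | [] => [∅]
  | a :: l => grayCode l ++ ((grayCode l).map (insert a)).reverse

theorem length_grayCode (l : List α) : (grayCode l).length = 2 ^ l.length := by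
  induction l with
  | nil => rfl
  | cons a l ih => simp [grayCode, ih, pow_succ, mul_two]

theorem head?_grayCode (l : List α) : (grayCode l).head? = some ∅ := by
  induction l with
  | nil => rfl
  | cons a l ih => simp [grayCode, ih]

theorem getLast?_grayCode_cons (a : α) (l : List α) :
    (grayCode (a :: l)).getLast? = some {a} := by
  simp [grayCode, head?_grayCode]

theorem subset_of_mem_grayCode {l : List α} {X : Set α} (hX : X ∈ grayCode l) :
    X ⊆ {a | a ∈ l} := by
  induction l generalizing X with
  | nil => simp_all [grayCode]
  | cons a l ih =>
    simp only [grayCode, List.mem_append, List.mem_reverse, List.mem_map] at hX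
    rcases hX with hX | ⟨Y, hY, rfl⟩
    · exact fun b hb => List.mem_cons_of_mem a (ih hX hb)
    · exact Set.insert_subset (by simp) fun b hb => List.mem_cons_of_mem a (ih hY hb)

theorem nodup_grayCode {l : List α} (hl : l.Nodup) : (grayCode l).Nodup := by
  induction l with
  | nil => exact List.nodup_singleton ∅
  | cons a l ih =>
    obtain ⟨ha, hl⟩ := List.nodup_cons.1 hl
    have ha_notMem {X} (hX : X ∈ grayCode l) : a ∉ X := fun h => ha (subset_of_mem_grayCode hX h)
    refine (ih hl).append (List.nodup_reverse.2 ((ih hl).map_on fun X hX Y hY h => ?_)) ?_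
    · rw [← Set.insert_sdiff_self_of_notMem (ha_notMem hX), h,
        Set.insert_sdiff_self_of_notMem (ha_notMem hY)]
    · intro X hX hX'
      obtain ⟨Y, -, rfl⟩ := List.mem_map.1 (List.mem_reverse.1 hX')
      exact ha_notMem hX (Set.mem_insert a Y)

theorem isChain_grayCode (l : List α) : (grayCode l).IsChain DifferAtMostOnce := by
  induction l with
  | nil => exact List.isChain_singleton ∅
  | cons a l ih =>
    refine List.isChain_append.2 ⟨ih, List.isChain_reverse.2 ((List.isChain_map _).2 (ih.imp
      fun X Y h => (h.insert a).symm)), fun X hX Y hY => ?_⟩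
    obtain ⟨Z, hZ, rfl⟩ : ∃ Z, (grayCode l).getLast? = some Z ∧ insert a Z = Y := by
      simpa using hY
    obtain rfl : Z = X := Option.some.inj (hZ.symm.trans hX)
    exact differAtMostOnce_insert a Z

theorem exists_cyclic_grayCode (α : Type*) [Fintype α] [Nonempty α] :
    ∃ g : ZMod (2 ^ Fintype.card α) → Set α, Function.Injective g ∧ g 0 = ∅ ∧
      ∀ t, DifferAtMostOnce (g t) (g (t + 1)) := by
  obtain ⟨a, l, hal⟩ : ∃ a l, (Finset.univ : Finset α).toList = a :: l :=
    List.exists_cons_of_ne_nil (by simp [Finset.univ_nonempty.ne_empty])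
  have hlength : (grayCode (a :: l)).length = 2 ^ Fintype.card α := by
    rw [length_grayCode, ← hal, Finset.length_toList, Finset.card_univ]
  have hwrap : DifferAtMostOnce {a} ∅ := by
    simpa using (differAtMostOnce_insert a ∅).symm
  exact exists_injective_cycle_of_isChain hlength (nodup_grayCode (hal ▸ Finset.nodup_toList _))
    (isChain_grayCode _) (head?_grayCode _) (getLast?_grayCode_cons a l) hwrap

end GrayCode

namespace MemorySpec

open Function (update)

/-- The input signals of the specification, for address bits indexed by `ι`. Every letter writes
`value` to its address; `query` marks the letter that asks for the value stored at its address, and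
`side` is a bit that the system has to repeat one step later. -/
inductive Input (ι : Type) : Type where
  | bit (i : ι)
  | query
  | value
  | side

/-- The output signals of the specification: the answer to a query, and the previous value of
`side`. -/
inductive Output : Type where
  | answer
  | echo

open Input Output LTL

variable {ι : Type}

instance [Finite ι] : Finite (Input ι) :=
  Finite.of_surjective (Sum.elim bit ![query, value, side] : ι ⊕ Fin 3 → Input ι) (by
    rintro (i | _ | _ | _)
    exacts [⟨.inl i, rfl⟩, ⟨.inr 0, rfl⟩, ⟨.inr 1, rfl⟩, ⟨.inr 2, rfl⟩])

instance : Finite Output :=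
  Finite.of_surjective (fun b : Bool => if b then answer else echo) (by
    rintro (_ | _)
    exacts [⟨true, rfl⟩, ⟨false, rfl⟩])

/-- The address in a letter. -/
def address (ν : Set (Input ι)) : Set ι := bit ⁻¹' ν

/-- The effect of a letter on the memory, a memory being the set of addresses with value `1`. -/
def write (m : Set (Set ι)) (ν : Set (Input ι)) : Set (Set ι) :=
  {a | address ν = a ∧ value ∈ ν ∨ address ν ≠ a ∧ a ∈ m}

/-- The memory after the first `k` letters of an input word. -/
def memory (w : ℕ → Set (Input ι)) : ℕ → Set (Set ι)
  | 0 => ∅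
  | k + 1 => write (memory w k) (w k)

theorem memory_update {w : ℕ → Set (Input ι)} {j k : ℕ} (hj : j ≤ k) (ν : Set (Input ι)) :
    memory (update w k ν) j = memory w j := by
  induction j with
  | zero => rfl
  | succ j ih => rw [memory, memory, ih (by omega), Function.update_of_ne (by omega)]

theorem mem_memory_iff {w : ℕ → Set (Input ι)} {q : ℕ} {a : Set ι} :
    a ∈ memory w q ↔ ∃ k < q, address (w k) = a ∧ value ∈ w k ∧
      ∀ j, k ≤ j → j < q → address (w j) = a → value ∈ w j := by
  induction q with
  | zero => simp [memory]
  | succ q ih =>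
    by_cases ha : address (w q) = a
    · have hwrite : a ∈ memory w (q + 1) ↔ value ∈ w q := by simp [memory, write, ha]
      rw [hwrite]
      constructor
      · intro hv
        refine ⟨q, q.lt_succ_self, ha, hv, fun j hqj hjq _ => ?_⟩
        rwa [show j = q by omega]
      · rintro ⟨k, hk, -, -, hlater⟩
        exact hlater q (by omega) q.lt_succ_self ha
    · have hkeep : a ∈ memory w (q + 1) ↔ a ∈ memory w q := by simp [memory, write, ha]
      have hne {k} (hk : address (w k) = a) : k ≠ q := by rintro rfl; exact ha hk
      rw [hkeep, ih]
      constructor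
      · rintro ⟨k, hk, hka, hv, hlater⟩
        exact ⟨k, by omega, hka, hv, fun j hkj hjq hja =>
          hlater j hkj (by have := hne hja; omega) hja⟩
      · rintro ⟨k, hk, hka, hv, hlater⟩
        exact ⟨k, by have := hne hka; omega, hka, hv, fun j hkj hjq => hlater j hkj (by omega)⟩

theorem exists_word_of_differAtMostOnce {m : ℕ → Set (Set ι)} (hinit : m 0 = ∅)
    (hm : ∀ k, DifferAtMostOnce (m k) (m (k + 1))) (β : Set ℕ) :
    ∃ w : ℕ → Set (Input ι), (∀ k, query ∉ w k) ∧ memory w = m ∧ ∀ k, side ∈ w k ↔ k ∈ β := by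
  choose a ha using hm
  let w (k : ℕ) : Set (Input ι) :=
    bit '' a k ∪ {x | x = value ∧ a k ∈ m (k + 1) ∨ x = side ∧ k ∈ β}
  have haddress (k : ℕ) : address (w k) = a k := by ext; simp [w, address]
  have hvalue (k : ℕ) : value ∈ w k ↔ a k ∈ m (k + 1) := by simp [w]
  refine ⟨w, fun k => by simp [w], funext fun k => ?_, fun k => by simp [w]⟩
  induction k with
  | zero => exact hinit.symm
  | succ k ih =>
    ext b
    rw [memory, ih]
    rcases eq_or_ne (a k) b with rfl | hb
    · simp [write, haddress, hvalue]
    · simp [write, haddress, hb, ha k b hb.symm]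

/-- The formulas over the signals of the specification. -/
abbrev Formula (ι : Type) : Type := LTL (Input ι ⊕ Output)

/-- An input signal as a formula. -/
abbrev inp (x : Input ι) : Formula ι := atom (Sum.inl x)

/-- An output signal as a formula. -/
abbrev outp (x : Output) : Formula ι := atom (Sum.inr x)

/-- The current address and the address at the query have the same bit at `i`. -/
def sameBit (i : ι) : Formula ι :=
  (inp (bit i)).iff ((inp query).and (inp (bit i))).eventually

section Spec

variable (ι) [Fintype ι]

/-- The query is not over and the current address is the address at the query. Comparing the current
letter with the queried one bit by bit is what keeps the formula of linear size. -/
noncomputable def sameAddress : Formula ι :=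
  (inp query).eventually.and (conj (Finset.univ.toList.map sameBit))

/-- There is exactly one query. -/
def uniqueQuery : Formula ι :=
  (inp query).eventually.and ((inp query).imp (inp query).not.globally.next).globally

/-- The address at the query has value `1` when the query comes: the value is written before, and no
later letter before the query overwrites it with `0`. -/
noncomputable def stored : Formula ι :=
  ((sameAddress ι).and ((inp query).not.and ((inp value).and
    ((sameAddress ι).imp ((inp value).or (inp query))).globally))).eventually

/-- The system repeats `side` with delay one, and if there is exactly one query, it answers this
query correctly. -/
noncomputable def spec : Formula ι :=
  ((inp side).iff (outp echo).next).globally.and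
    ((uniqueQuery ι).imp ((stored ι).iff ((inp query).and (outp answer)).eventually))

theorem onlyXGF_sameAddress : (sameAddress ι).OnlyXGF := by
  refine (OnlyXGF.atom _).eventually.and (.conj fun χ hχ => ?_)
  obtain ⟨i, -, rfl⟩ := List.mem_map.1 hχ
  exact (OnlyXGF.atom _).iff ((OnlyXGF.atom _).and (.atom _)).eventually

theorem onlyXGF_spec : (spec ι).OnlyXGF := by
  have hsame := onlyXGF_sameAddress ι
  have hatom (x : Input ι ⊕ Output) : (atom x).OnlyXGF := .atom x
  have hunique : (uniqueQuery ι).OnlyXGF :=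
    (hatom _).eventually.and ((hatom _).imp (hatom _).not.globally.next).globally
  have hstored : (stored ι).OnlyXGF :=
    (hsame.and ((hatom _).not.and ((hatom _).and
      (hsame.imp ((hatom _).or (hatom _))).globally))).eventually
  exact ((hatom _).iff (hatom _).next).globally.and
    (hunique.imp (hstored.iff ((hatom _).and (hatom _)).eventually))

theorem size_spec_le : (spec ι).size ≤ 120 * Fintype.card ι + 180 := by
  have hconj : (conj (Finset.univ.toList.map (sameBit (ι := ι)))).length ≤
      (26 + 4) * Fintype.card ι + 1 := by
    refine (length_conj_le (c := 26) fun χ hχ => ?_).trans (by simp)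
    obtain ⟨i, -, rfl⟩ := List.mem_map.1 hχ
    simp [sameBit, iff, LTL.and, imp, eventually, length]
  refine (size_le_length _).trans ?_
  simp only [spec, stored, uniqueQuery, sameAddress, iff, LTL.and, imp, eventually, globally,
    length]
  omega

theorem card_le_size_spec : Fintype.card ι ≤ (spec ι).size := by
  rw [← Nat.card_eq_fintype_card]
  refine card_le_size_of_injective (a := fun i : ι => Sum.inl (bit i))
    (fun i j h => by simpa using h) fun i => ?_
  have hbit : inp (bit i) ∈ (sameBit i).subformulas :=
    mem_subformulas_iff (Or.inl (self_mem_subformulas _))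
  have hsame : inp (bit i) ∈ (sameAddress ι).subformulas :=
    mem_subformulas_and (Or.inr (mem_subformulas_conj (List.mem_map_of_mem (by simp)) hbit))
  have hstored : inp (bit i) ∈ (stored ι).subformulas :=
    Or.inr (Or.inr (mem_subformulas_and (Or.inl hsame)))
  exact mem_subformulas_and (Or.inr (Or.inr (Or.inr (mem_subformulas_iff (Or.inl hstored)))))

end Spec

open Asymptotics in
theorem isTheta_size_spec :
    IsTheta Filter.atTop (fun n : ℕ => ((spec (Fin n)).size : ℝ)) (fun n : ℕ => (n : ℝ)) := by
  constructor
  · refine IsBigO.of_bound 300 ?_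
    filter_upwards [Filter.eventually_ge_atTop 1] with n hn
    have hsize := size_spec_le (Fin n)
    rw [Fintype.card_fin] at hsize
    rw [Real.norm_natCast, Real.norm_natCast]
    exact_mod_cast (by omega : (spec (Fin n)).size ≤ 300 * n)
  · refine IsBigO.of_bound 1 (Filter.Eventually.of_forall fun n => ?_)
    have hsize := card_le_size_spec (Fin n)
    rw [Fintype.card_fin] at hsize
    rw [Real.norm_natCast, Real.norm_natCast, one_mul]
    exact_mod_cast hsize

section Semantics

variable {M : MealyMachine (Input ι) Output} {w : ℕ → Set (Input ι)}

theorem sat_uniqueQuery :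
    Sat (M.trace w) 0 (uniqueQuery ι) ↔ ∃ q, ∀ k, query ∈ w k ↔ k = q := by
  simp only [uniqueQuery, sat_and, sat_eventually, sat_globally, sat_imp, sat_next, sat_not,
    M.sat_input, Nat.zero_le, true_and, true_imp_iff]
  constructor
  · rintro ⟨⟨q, hq⟩, hlater⟩
    refine ⟨q, fun k => ⟨fun hk => ?_, fun hk => hk ▸ hq⟩⟩
    rcases lt_trichotomy k q with hlt | heq | hgt
    · exact absurd hq (hlater k hk q hlt)
    · exact heq
    · exact absurd hk (hlater q hq k hgt)
  · rintro ⟨q, hq⟩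
    refine ⟨⟨q, (hq q).2 rfl⟩, fun j hj k hjk hk => ?_⟩
    rw [hq] at hj hk
    omega

variable [Fintype ι]

theorem sat_sameAddress {q : ℕ} (hq : ∀ k, query ∈ w k ↔ k = q) (k : ℕ) :
    Sat (M.trace w) k (sameAddress ι) ↔ k ≤ q ∧ address (w k) = address (w q) := by
  have hquery : Sat (M.trace w) k (inp query).eventually ↔ k ≤ q := by
    simp [sat_eventually, M.sat_input, hq]
  have hbit (hk : k ≤ q) (i : ι) :
      Sat (M.trace w) k (sameBit i) ↔ (bit i ∈ w k ↔ bit i ∈ w q) := by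
    simp [sameBit, sat_iff, sat_eventually, sat_and, M.sat_input, hq, hk]
  rw [sameAddress, sat_and, hquery, sat_conj, List.forall_mem_map]
  refine and_congr_right fun hk => ?_
  simp [hbit hk, Set.ext_iff, address]

theorem sat_stored {q : ℕ} (hq : ∀ k, query ∈ w k ↔ k = q) :
    Sat (M.trace w) 0 (stored ι) ↔ address (w q) ∈ memory w q := by
  simp only [stored, sat_and, sat_eventually, sat_globally, sat_imp, sat_not, sat_or,
    sat_sameAddress hq, M.sat_input, hq, mem_memory_iff, Nat.zero_le, true_and]
  refine exists_congr fun k => ⟨?_, ?_⟩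
  · rintro ⟨⟨hkq, haddress⟩, hne, hv, hlater⟩
    exact ⟨by omega, haddress, hv, fun j hkj hjq hj =>
      (hlater j hkj ⟨hjq.le, hj⟩).resolve_right hjq.ne⟩
  · rintro ⟨hkq, haddress, hv, hlater⟩
    exact ⟨⟨hkq.le, haddress⟩, hkq.ne, hv, fun j hkj ⟨hjq, hj⟩ =>
      hjq.lt_or_eq.imp_left fun hlt => hlater j hkj hlt hj⟩

theorem implements_spec_iff :
    M.Implements (spec ι) ↔ ∀ w,
      (∀ k, side ∈ w k ↔ echo ∈ M.out (M.run w (k + 1)) (w (k + 1))) ∧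
      ∀ q, (∀ k, query ∈ w k ↔ k = q) →
        (address (w q) ∈ memory w q ↔ answer ∈ M.out (M.run w q) (w q)) := by
  rw [M.implements_iff]
  refine forall_congr' fun w => ?_
  rw [spec, sat_and, sat_imp, sat_uniqueQuery, forall_exists_index]
  refine and_congr ?_ (forall_congr' fun q => forall_congr' fun hq => ?_)
  · simp [sat_globally, sat_iff, sat_next, M.sat_input, M.sat_output]
  · simp [sat_iff, sat_stored hq, sat_eventually, sat_and, M.sat_input, M.sat_output, hq]

end Semantics

/-- The canonical implementation, whose state holds the memory and the last value of `side`. -/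
def memoryMachine (ι : Type) [Finite ι] : MealyMachine (Input ι) Output where
  State := Set (Set ι) × Prop
  finite_state := inferInstance
  init := (∅, False)
  step s ν := (write s.1 ν, side ∈ ν)
  out s ν := {o | o = answer ∧ address ν ∈ s.1 ∨ o = echo ∧ s.2}

theorem run_memoryMachine [Finite ι] (w : ℕ → Set (Input ι)) (k : ℕ) :
    ((memoryMachine ι).run w k).1 = memory w k := by
  induction k with
  | zero => rfl
  | succ k ih => rw [memory, ← ih]; rfl

theorem realizable_spec (ι : Type) [Fintype ι] : (spec ι).Realizable := by
  refine ⟨memoryMachine ι, implements_spec_iff.2 fun w => ⟨fun k => ?_, fun q _ => ?_⟩⟩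
  · simp [memoryMachine, MealyMachine.run]
  · rw [← run_memoryMachine]
    simp [memoryMachine]

section Implementations

variable [Fintype ι] {M : MealyMachine (Input ι) Output} {w : ℕ → Set (Input ι)}

theorem mem_memory_iff_answer (hM : M.Implements (spec ι)) (hw : ∀ k, query ∉ w k) (k : ℕ)
    (a : Set ι) :
    a ∈ memory w k ↔ answer ∈ M.out (M.run w k) (insert query (bit '' a)) := by
  let u := update w k (insert query (bit '' a))
  have hu : u k = insert query (bit '' a) := Function.update_self ..
  have haddress : address (u k) = a := by ext; simp [hu, address]
  have hquery (j : ℕ) : query ∈ u j ↔ j = k := by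
    rcases eq_or_ne j k with rfl | hj
    · simp [hu]
    · simp [u, hj, hw]
  have hanswer := (implements_spec_iff.1 hM u).2 k hquery
  rwa [haddress, hu, memory_update le_rfl, M.run_update le_rfl] at hanswer

theorem side_mem_iff_echo (hM : M.Implements (spec ι)) (k : ℕ) :
    side ∈ w k ↔ echo ∈ M.out (M.run w (k + 1)) ∅ := by
  have hecho := (implements_spec_iff.1 hM (update w (k + 1) ∅)).1 k
  rwa [Function.update_of_ne k.lt_succ_self.ne, Function.update_self, M.run_update le_rfl] at hecho

theorem le_ncard_cycles (hM : M.Implements (spec ι)) :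
    2 ^ 2 ^ 2 ^ Fintype.card ι ≤ M.cycles.ncard := by
  have := M.finite_state
  obtain ⟨g, hg_inj, hg_zero, hg⟩ := exists_cyclic_grayCode (Set ι)
  rw [← Fintype.card_set]
  choose w hquery hmemory hside using fun β : Set (ZMod (2 ^ Fintype.card (Set ι))) =>
    exists_word_of_differAtMostOnce (m := fun k => g k) (by simpa using hg_zero)
      (fun k => by simpa using hg k) {k | (k : ZMod (2 ^ Fintype.card (Set ι))) ∈ β}
  refine two_pow_le_ncard_simpleCycles (f := fun β k => M.run (w β) (k + 1))
    (fun β k => ⟨w β (k + 1), rfl⟩) fun β γ k l hrun => ⟨?_, ?_⟩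
  · have hmem : memory (w β) (k + 1) = memory (w γ) (l + 1) := by
      ext a
      rw [mem_memory_iff_answer hM (hquery β), mem_memory_iff_answer hM (hquery γ), hrun]
    rw [hmemory, hmemory] at hmem
    simpa using hg_inj hmem
  · have hside_eq : side ∈ w β k ↔ side ∈ w γ l := by
      rw [side_mem_iff_echo hM, hrun, ← side_mem_iff_echo hM]
    rwa [hside, hside] at hside_eq

end Implementations

end MemorySpec

theorem mainTheorem2 :
    ∃ (I O : ℕ → Type) (φ : (n : ℕ) → LTL (I n ⊕ O n)),
      (∀ n, Finite (I n) ∧ Finite (O n)) ∧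
      Asymptotics.IsTheta Filter.atTop (fun n : ℕ => ((φ n).size : ℝ)) (fun n : ℕ => (n : ℝ)) ∧
      ∀ n : ℕ, 1 < n →
        (φ n).OnlyXGF ∧
        (φ n).Realizable ∧
        ∀ M : MealyMachine (I n) (O n), M.Implements (φ n) →
          2 ^ 2 ^ 2 ^ n ≤ M.cycles.ncard := by
  refine ⟨fun n => MemorySpec.Input (Fin n), fun _ => MemorySpec.Output,
    fun n => MemorySpec.spec (Fin n), fun n => ⟨inferInstance, inferInstance⟩,
    MemorySpec.isTheta_size_spec, fun n _ => ⟨MemorySpec.onlyXGF_spec (Fin n),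
      MemorySpec.realizable_spec (Fin n), fun M hM => ?_⟩⟩
  simpa only [Fintype.card_fin] using MemorySpec.le_ncard_cycles hM
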